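/- Let $\mathbb T\subset\mathbb C$ be the unit circle. Let $\mathfrak F$ be the Farey tessellation of the unit disk $\mathbb D$, that is, the ideal triangulation generated from the ideal triangle with vertices $1, i, -1$ by repeated reflections across edges, and let $E$ be its set of (unoriented) edges. For $e=(a,c)\in E$, let $Q_e=(a,b,c,d)$ denote the quadrilateral formed by the two triangles of $\mathfrak F$ adjacent to $e$, with vertices listed in counterclockwise order. For an orientation-preserving homeomorphism $h:\mathbb T\to\mathbb T$ fixing $1$, $i$ and $-1$, its shear coordinate $s_h:E\to\mathbb R$ is $$s_h(e)=\log\frac{(h(b)-h(a))(h(d)-h(c))}{(h(c)-h(b))(h(d)-h(a))},\qquad e=(a,c),\ Q_e=(a,b,c,d).$$ A function $s:E\to\mathbb R$ (a shear function) is said to induce a circle homeomorphism if $s=s_h$ for some such $h$. Such an $h$ is quasisymmetric if there is $M\ge1$ such that $M^{-1}\le |h(I)|/|h(J)|\le M$ for all adjacent arcs $I,J\subset\mathbb T$ of equal length, where $|\cdot|$ is arc length. Let $\mathcal S=\{s:E\to\mathbb R : \sum_{e\in E}s(e)^2<\infty\}$. Then: 1. there exists $s\in\mathcal S$ that does not induce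 a circle homeomorphism; 2. there exists a quasisymmetric orientation-preserving homeomorphism $h:\mathbb T\to\mathbb T$ fixing $1$, $i$ and $-1$ such that $s_h\notin\mathcal S$. -/

import Mathlib

open scoped ComplexConjugate

namespace FareyShear

/-- The point `i` of the unit circle. -/
def circleI : Circle := ⟨Complex.I, by simp [Submonoid.unitSphere]⟩

/-- The hyperbolic reflection of the (closed) unit disk across the geodesic with distinct
endpoints `a`, `b` on the unit circle: the anti-Möbius map that preserves the disk and fixes
`a` and `b`. -/
noncomputable def geodesicReflection (a b : Circle) (z : ℂ) : ℂ :=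
  (((a : ℂ) + b) - 2 * a * b * conj z) / (2 - ((a : ℂ) + b) * conj z)

/-- `FareyTriangle a b c`: the ideal triangle with vertices `a`, `b`, `c`, listed in
counterclockwise order, is a triangle of the Farey tessellation. The tessellation is generated
from the triangle `(1, i, -1)` by reflecting triangles across their edges. -/
inductive FareyTriangle : Circle → Circle → Circle → Prop
  | base : FareyTriangle 1 circleI (-1)
  | rotate {a b c : Circle} : FareyTriangle a b c → FareyTriangle b c a
  | reflect {a b c d : Circle} : FareyTriangle a b c →
      (d : ℂ) = geodesicReflection a c b → FareyTriangle a c d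

/-- The edges `E` of the Farey tessellation, as unordered pairs of endpoints. -/
def FareyEdge : Type :=
  {e : Sym2 Circle // ∃ a b c : Circle, FareyTriangle a b c ∧ e = s(a, c)}

/-- `(a, b, c, d)`, in counterclockwise order, are the vertices of the Farey quad around the
edge `(a, c)`, the union of the two triangles of the tessellation that share this edge. -/
def IsFareyQuad (a b c d : Circle) : Prop :=
  FareyTriangle a b c ∧ FareyTriangle c d a

/-! Existence and uniqueness of the Farey quad around an edge. -/

/-- The point of the circle with coordinate `p / q` in the half-plane model. -/
noncomputable def rationalVertex (p q : ℤ) : ℂ :=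
  ((p : ℂ) - q * Complex.I) / (p + q * Complex.I)

theorem rationalVertex_den_ne_zero {p q : ℤ} (h : p ≠ 0 ∨ q ≠ 0) :
    (p : ℂ) + q * Complex.I ≠ 0 := by
  intro h0
  have h1 := congrArg Complex.re h0
  have h2 := congrArg Complex.im h0
  simp at h1 h2
  tauto

theorem rationalVertex_neg (p q : ℤ) : rationalVertex (-p) (-q) = rationalVertex p q := by
  unfold rationalVertex
  push_cast
  rw [← neg_div_neg_eq]
  congr 1 <;> ring

theorem rationalVertex_eq {p q p' q' : ℤ} (h : p ≠ 0 ∨ q ≠ 0) (h' : p' ≠ 0 ∨ q' ≠ 0)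
    (he : rationalVertex p q = rationalVertex p' q') : p * q' = q * p' := by
  unfold rationalVertex at he
  rw [div_eq_div_iff (rationalVertex_den_ne_zero h) (rationalVertex_den_ne_zero h')] at he
  have h2 := congrArg Complex.im he
  simp at h2
  have h3 : (p : ℝ) * q' = q * p' := by linarith
  exact_mod_cast h3

theorem norm_rationalVertex {p q : ℤ} (h : p ≠ 0 ∨ q ≠ 0) : ‖rationalVertex p q‖ = 1 := by
  have h1 : (p : ℂ) - q * Complex.I = conj ((p : ℂ) + q * Complex.I) := by
    simp [sub_eq_add_neg]
  rw [rationalVertex, h1, norm_div, RCLike.norm_conj, div_self]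
  exact norm_ne_zero_iff.2 (rationalVertex_den_ne_zero h)

theorem reflection_algebra {P P' R R' : ℂ} (hP : P ≠ 0) (hR : R ≠ 0) (_ : P + R ≠ 0)
    (hS' : P' + R' ≠ 0) (hT : R - P ≠ 0) (hD : R' * P - P' * R ≠ 0) :
    ((P' / P + R' / R) - 2 * (P' / P) * (R' / R) * ((P' + R') / (P + R))⁻¹) /
      (2 - (P' / P + R' / R) * ((P' + R') / (P + R))⁻¹) = (R' - P') / (R - P) := by
  have e1 : (P' / P + R' / R) - 2 * (P' / P) * (R' / R) * ((P' + R') / (P + R))⁻¹ =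
      (R' * P - P' * R) * (R' - P') / (P * R * (P' + R')) := by
    field_simp
    ring
  have e2 : 2 - (P' / P + R' / R) * ((P' + R') / (P + R))⁻¹ =
      (R' * P - P' * R) * (R - P) / (P * R * (P' + R')) := by
    field_simp
    ring
  rw [e1, e2]
  field_simp

theorem geodesicReflection_rational {a b c : Circle} {p q r s : ℤ} (hd : p * s - q * r = -1)
    (ha : (a : ℂ) = rationalVertex p q) (hb : (b : ℂ) = rationalVertex (p + r) (q + s))
    (hc : (c : ℂ) = rationalVertex r s) :
    geodesicReflection a c b = rationalVertex (r - p) (s - q) := by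
  have e3 : (p + r) * s - (q + s) * r = -1 := by linarith
  have e4 : (r - p) * s - (s - q) * r = 1 := by linarith
  have n1 := rationalVertex_den_ne_zero (p := p) (q := q) (by
    by_contra! h; simp [h.1, h.2] at hd)
  have n2 := rationalVertex_den_ne_zero (p := r) (q := s) (by
    by_contra! h; simp [h.1, h.2] at hd)
  have n3 := rationalVertex_den_ne_zero (p := p + r) (q := q + s) (by
    by_contra! h; rw [h.1, h.2] at e3; simp at e3)
  have n4 := rationalVertex_den_ne_zero (p := r - p) (q := s - q) (by
    by_contra! h; rw [h.1, h.2] at e4; simp at e4)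
  have n5 : ((p + r : ℤ) : ℂ) - ((q + s : ℤ) : ℂ) * Complex.I ≠ 0 := by
    intro h
    apply b.coe_ne_zero
    rw [hb, rationalVertex, h, zero_div]
  have hdc : (p : ℂ) * s - q * r = -1 := by exact_mod_cast hd
  have key := reflection_algebra (P := p + q * Complex.I) (P' := p - q * Complex.I)
    (R := r + s * Complex.I) (R' := r - s * Complex.I) n1 n2
    (by convert n3 using 1; push_cast; ring) (by convert n5 using 1; push_cast; ring)
    (by convert n4 using 1; push_cast; ring)
    (by
      have : ((r : ℂ) - s * Complex.I) * (p + q * Complex.I) -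
          (p - q * Complex.I) * (r + s * Complex.I) = 2 * Complex.I := by
        linear_combination (-2 * Complex.I) * hdc
      rw [this]
      simp)
  have hbc : conj (b : ℂ) = (b : ℂ)⁻¹ := by
    rw [← Circle.coe_inv_eq_conj, Circle.coe_inv]
  rw [geodesicReflection, hbc, ha, hb, hc]
  unfold rationalVertex
  convert key using 1
  · push_cast
    ring_nf
  · push_cast
    ring_nf

theorem FareyTriangle.exists_rational {a b c : Circle} (h : FareyTriangle a b c) :
    ∃ p q r s : ℤ, p * s - q * r = -1 ∧ (a : ℂ) = rationalVertex p q ∧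
      (b : ℂ) = rationalVertex (p + r) (q + s) ∧ (c : ℂ) = rationalVertex r s := by
  induction h with
  | base =>
    refine ⟨-1, 0, 0, 1, by norm_num, ?_, ?_, ?_⟩
    · simp [rationalVertex]
    · have h1 : (-1 : ℂ) + Complex.I ≠ 0 := by
        intro h
        simpa using congrArg Complex.im h
      simp only [rationalVertex, circleI]
      push_cast
      rw [eq_div_iff (by simpa using h1)]
      linear_combination Complex.I_sq
    · simp [rationalVertex]
  | rotate _ ih =>
    obtain ⟨p, q, r, s, hd, ha, hb, hc⟩ := ih
    refine ⟨p + r, q + s, -p, -q, by linarith, hb, ?_, ?_⟩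
    · simpa using hc
    · rw [rationalVertex_neg, ha]
  | reflect _ hr ih =>
    obtain ⟨p, q, r, s, hd, ha, hb, hc⟩ := ih
    refine ⟨p, q, r - p, s - q, by linarith, ha, by simpa using hc, ?_⟩
    rw [hr, geodesicReflection_rational hd ha hb hc]

theorem FareyTriangle.exists_reflect {a b c : Circle} (h : FareyTriangle a b c) :
    ∃ d, FareyTriangle a c d := by
  obtain ⟨p, q, r, s, hd, ha, hb, hc⟩ := h.exists_rational
  have hn : ‖rationalVertex (r - p) (s - q)‖ = 1 := by
    apply norm_rationalVertex
    by_contra! h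
    have e4 : (r - p) * s - (s - q) * r = 1 := by linarith
    rw [h.1, h.2] at e4
    simp at e4
  exact ⟨⟨rationalVertex (r - p) (s - q), mem_sphere_zero_iff_norm.2 hn⟩,
    h.reflect (geodesicReflection_rational hd ha hb hc).symm⟩

theorem FareyTriangle.apex_unique {a b c b' : Circle} (h : FareyTriangle a b c)
    (h' : FareyTriangle a b' c) : b = b' := by
  obtain ⟨p, q, r, s, hd, ha, hb, hc⟩ := h.exists_rational
  obtain ⟨p', q', r', s', hd', ha', hb', hc'⟩ := h'.exists_rational
  have e1 : p * q' = q * p' := by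
    apply rationalVertex_eq _ _ (ha.symm.trans ha')
    · by_contra! h; simp [h.1, h.2] at hd
    · by_contra! h; simp [h.1, h.2] at hd'
  have e2 : r * s' = s * r' := by
    apply rationalVertex_eq _ _ (hc.symm.trans hc')
    · by_contra! h; simp [h.1, h.2] at hd
    · by_contra! h; simp [h.1, h.2] at hd'
  obtain ⟨l, hl⟩ : ∃ l, l = q' * r - p' * s := ⟨_, rfl⟩
  obtain ⟨m, hm⟩ : ∃ m, m = q * r' - p * s' := ⟨_, rfl⟩
  have p1 : p' = l * p := by subst hl; linear_combination p' * hd - r * e1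
  have p2 : q' = l * q := by subst hl; linear_combination q' * hd - s * e1
  have p3 : r' = m * r := by subst hm; linear_combination r' * hd + p * e2
  have p4 : s' = m * s := by subst hm; linear_combination s' * hd + q * e2
  have hlm : l * m = 1 := by
    rw [p1, p2, p3, p4] at hd'
    linear_combination (-1 : ℤ) * hd' + l * m * hd
  apply Circle.ext
  rw [hb, hb']
  rcases Int.eq_one_or_neg_one_of_mul_eq_one' hlm with ⟨rfl, rfl⟩ | ⟨rfl, rfl⟩
  · rw [p1, p2, p3, p4]
    simp
  · rw [p1, p2, p3, p4, ← rationalVertex_neg]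
    congr 1 <;> ring

theorem FareyEdge.exists_quad (e : FareyEdge) :
    ∃ Q : Circle × Circle × Circle × Circle,
      e.1 = s(Q.1, Q.2.2.1) ∧ IsFareyQuad Q.1 Q.2.1 Q.2.2.1 Q.2.2.2 := by
  obtain ⟨a, b, c, h, he⟩ := e.2
  obtain ⟨d, hd⟩ := h.exists_reflect
  exact ⟨(a, b, c, d), he, h, hd.rotate⟩

/-- The vertices `(a, b, c, d)` of the Farey quad `Q_e` around the edge `e = (a, c)`, in
counterclockwise order (unique up to exchanging it with `(c, d, a, b)`). -/
noncomputable def FareyEdge.quad (e : FareyEdge) : Circle × Circle × Circle × Circle :=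
  e.exists_quad.choose

theorem FareyEdge.quad_eq_or (e : FareyEdge) {a b c d : Circle} (he : e.1 = s(a, c))
    (h : IsFareyQuad a b c d) : e.quad = (a, b, c, d) ∨ e.quad = (c, d, a, b) := by
  obtain ⟨h1, h2, h3⟩ := e.exists_quad.choose_spec
  change e.1 = s(e.quad.1, e.quad.2.2.1) at h1
  change FareyTriangle e.quad.1 e.quad.2.1 e.quad.2.2.1 at h2
  change FareyTriangle e.quad.2.2.1 e.quad.2.2.2 e.quad.1 at h3
  generalize e.quad = Q at *
  obtain ⟨a', b', c', d'⟩ := Q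
  simp only at h1 h2 h3
  rw [he, Sym2.eq_iff] at h1
  rcases h1 with ⟨rfl, rfl⟩ | ⟨rfl, rfl⟩
  · left
    rw [h.1.apex_unique h2, h.2.apex_unique h3]
  · right
    rw [h.1.apex_unique h3, h.2.apex_unique h2]

/-! Shears. -/

/-- The cross ratio `cr(a, b, c, d)`. -/
noncomputable def crossRatio (a b c d : ℂ) : ℂ :=
  ((b - a) * (d - c)) / ((c - b) * (d - a))

theorem crossRatio_swap (a b c d : ℂ) : crossRatio c d a b = crossRatio a b c d := by
  unfold crossRatio
  congr 1 <;> ring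

/-- The shear along `(a, c)` of the quad with vertices `a, b, c, d` in counterclockwise order on
the circle: the logarithm of its cross ratio, which is a positive real number. -/
noncomputable def quadShear (a b c d : Circle) : ℝ :=
  Real.log (crossRatio a b c d).re

/-- The shear coordinate `s_h` of a circle homeomorphism `h`: its value at the edge `e` is the
shear along `h(e)` of the quad `h(Q_e)`. -/
noncomputable def shearCoordinate (h : Circle ≃ₜ Circle) (e : FareyEdge) : ℝ :=
  quadShear (h e.quad.1) (h e.quad.2.1) (h e.quad.2.2.1) (h e.quad.2.2.2)

theorem shearCoordinate_eq (h : Circle ≃ₜ Circle) (e : FareyEdge) {a b c d : Circle}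
    (he : e.1 = s(a, c)) (hQ : IsFareyQuad a b c d) :
    shearCoordinate h e = quadShear (h a) (h b) (h c) (h d) := by
  rcases e.quad_eq_or he hQ with h1 | h1
  · rw [shearCoordinate, h1]
  · rw [shearCoordinate, h1]
    simp only [quadShear]
    rw [crossRatio_swap]

/-- The class `𝓢` of square-summable shear functions. -/
def SquareSummable : Set (FareyEdge → ℝ) :=
  {s | Summable fun e => s e ^ 2}

/-! Circle homeomorphisms. -/

/-- The points `a, b, c` of the unit circle are distinct and in counterclockwise order. -/
def Counterclockwise (a b c : Circle) : Prop :=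
  0 < (conj ((b : ℂ) - a) * ((c : ℂ) - a)).im

def OrientationPreserving (h : Circle ≃ₜ Circle) : Prop :=
  ∀ a b c : Circle, Counterclockwise a b c → Counterclockwise (h a) (h b) (h c)

/-- The representatives of `Homeo⁺(𝕋) / Möb(𝕋)`: orientation-preserving homeomorphisms of the
circle that fix `1`, `i` and `-1`. -/
def NormalizedHomeo : Set (Circle ≃ₜ Circle) :=
  {h | OrientationPreserving h ∧ h 1 = 1 ∧ h circleI = circleI ∧ h (-1) = -1}

/-- Quasisymmetry of an orientation-preserving circle homeomorphism: the ratio of the lengths of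
the images of any two adjacent arcs of equal length is bounded above and below. The map `φ` is a
lift of `h` to the universal cover, so the arc from `exp(iu)` to `exp(iv)` is mapped to an arc of
length `φ v - φ u`. -/
def Quasisymmetric (h : Circle ≃ₜ Circle) : Prop :=
  ∃ φ : ℝ → ℝ, Continuous φ ∧ StrictMono φ ∧ (∀ x, h (Circle.exp x) = Circle.exp (φ x)) ∧
    ∃ M : ℝ, 1 ≤ M ∧ ∀ x t : ℝ, 0 < t → t ≤ Real.pi →
      M⁻¹ ≤ (φ (x + t) - φ x) / (φ x - φ (x - t)) ∧
        (φ (x + t) - φ x) / (φ x - φ (x - t)) ≤ M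

end FareyShear

/-! Both parts are decided on the fan of edges at the vertex `1`. In the coordinate sending `1` to
infinity, the fan joins infinity to the integers `n ≥ 1`, and for a homeomorphism fixing `1` the
shear at such an edge is the log of the ratio of two consecutive gaps between image vertices
(`shearCoordinate_fanEdge`).

Part 1: prescribe the ratios `(n + 1) / (n + 3)` on the fan and zero shear elsewhere. The shears are
of order `1 / n`, hence square-summable, but the gaps decay like `1 / n ^ 2` and have finite sum.
The images then stay bounded, although continuity at `1` drives them to infinity
(`shearCoordinate_ne_collapsingShear`).

Part 2: perturb the identity by a periodic displacement of Lipschitz constant `1 / 2`. The lift is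
bi-Lipschitz, hence the map is quasisymmetric (`exists_homeo_of_displacement`). The displacement is
chosen to fix the fan vertices `3j` and `3j + 2` and to move `3j + 1` by an amount bounded below in
the line coordinate (`tan_arctan_add_sub_mem`). Infinitely many shears then stay away from zero. -/

namespace FareyShear

open Filter Topology

/-! The real coordinate on the circle that sends `1` to infinity. -/

/-- The coordinate of a point of the circle in the half-plane model, where `1` is at infinity,
`-1` is at `0` and `i` is at `-1`. -/
noncomputable def lineCoord (z : Circle) : ℝ := 2 * (((z : ℂ) - 1)⁻¹).im

/-- Inversion about `1` carries the punctured circle to the line of real part `-1 / 2`, so the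
imaginary part determines the point. -/
theorem inv_sub_one_eq {z : Circle} (hz : z ≠ 1) :
    ((z : ℂ) - 1)⁻¹ = (lineCoord z * Complex.I - 1) / 2 := by
  have hn : (z : ℂ).re ^ 2 + (z : ℂ).im ^ 2 = 1 := by
    have h := Circle.normSq_coe z
    rw [Complex.normSq_apply] at h
    linarith
  have hre : (z : ℂ).re - 1 ≠ 0 := by
    intro h
    have h1 : (z : ℂ).re = 1 := by linarith
    have h2 : (z : ℂ).im = 0 := by
      rw [h1] at hn
      have : (z : ℂ).im ^ 2 = 0 := by linarith
      exact pow_eq_zero_iff two_ne_zero |>.1 this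
    exact hz (Circle.ext (Complex.ext (by simpa using h1) (by simpa using h2)))
  apply Complex.ext
  · have h2 : Complex.normSq ((z : ℂ) - 1) = -2 * ((z : ℂ).re - 1) := by
      rw [Complex.normSq_apply]
      simp only [Complex.sub_re, Complex.one_re, Complex.sub_im, Complex.one_im, sub_zero]
      linear_combination hn
    rw [Complex.inv_re, h2]
    simp only [Complex.sub_re, Complex.one_re]
    have : ((lineCoord z * Complex.I - 1) / 2 : ℂ).re = -1 / 2 := by simp
    rw [this]
    field_simp
  · simp [lineCoord]

theorem lineCoord_injOn : Set.InjOn lineCoord {1}ᶜ := by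
  intro z hz w hw h
  have h1 : ((z : ℂ) - 1)⁻¹ = ((w : ℂ) - 1)⁻¹ := by
    rw [inv_sub_one_eq hz, inv_sub_one_eq hw, h]
  exact Circle.ext (sub_left_injective (inv_injective h1))

/-- Quantitative form of "`1` is at infinity": a bounded coordinate keeps the point away from `1`.
-/
theorem one_le_norm_sub_one_mul {z : Circle} (hz : z ≠ 1) :
    1 ≤ ‖(z : ℂ) - 1‖ * (|lineCoord z| + 1) := by
  have h0 : (z : ℂ) - 1 ≠ 0 := by
    rw [sub_ne_zero]
    exact fun h => hz (Circle.ext (by simpa using h))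
  have h1 : ‖((z : ℂ) - 1)⁻¹‖ ≤ |lineCoord z| + 1 := by
    rw [inv_sub_one_eq hz, norm_div]
    have h2 : ‖(lineCoord z : ℂ) * Complex.I - 1‖ ≤ |lineCoord z| + 1 := by
      refine (norm_sub_le _ _).trans ?_
      simp
    have h3 : 0 ≤ |lineCoord z| := abs_nonneg _
    simp only [Complex.norm_ofNat]
    linarith
  have h4 : 0 < ‖(z : ℂ) - 1‖ := norm_pos_iff.2 h0
  rw [norm_inv] at h1
  calc 1 = ‖(z : ℂ) - 1‖ * ‖(z : ℂ) - 1‖⁻¹ := (mul_inv_cancel₀ h4.ne').symm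
    _ ≤ _ := mul_le_mul_of_nonneg_left h1 h4.le

/-- The cross ratio is Möbius invariant, and with one vertex at infinity it reduces to a ratio of
adjacent gaps. -/
theorem quadShear_one {b c d : Circle} (hb : b ≠ 1) (hc : c ≠ 1) (hd : d ≠ 1) :
    quadShear 1 b c d =
      Real.log ((lineCoord d - lineCoord c) / (lineCoord c - lineCoord b)) := by
  have ne {z : Circle} (hz : z ≠ 1) : (z : ℂ) - 1 ≠ 0 := by
    rw [sub_ne_zero]
    exact fun h => hz (Circle.ext (by simpa using h))
  have h1 : crossRatio (1 : Circle) b c d =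
      (((d : ℂ) - 1)⁻¹ - ((c : ℂ) - 1)⁻¹) / (((c : ℂ) - 1)⁻¹ - ((b : ℂ) - 1)⁻¹) := by
    have e1 : ((d : ℂ) - 1)⁻¹ - ((c : ℂ) - 1)⁻¹ =
        (c - d) / (((d : ℂ) - 1) * ((c : ℂ) - 1)) := by
      rw [inv_sub_inv (ne hd) (ne hc)]
      ring
    have e2 : ((c : ℂ) - 1)⁻¹ - ((b : ℂ) - 1)⁻¹ =
        (b - c) / (((c : ℂ) - 1) * ((b : ℂ) - 1)) := by
      rw [inv_sub_inv (ne hc) (ne hb)]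
      ring
    rw [e1, e2, crossRatio, Circle.coe_one]
    -- If `b = c`, both denominators vanish and both sides are `0` by convention.
    by_cases hbc : (b : ℂ) = c
    · simp [hbc]
    · have h3 : (b : ℂ) - c ≠ 0 := sub_ne_zero.2 hbc
      have h4 : (c : ℂ) - b ≠ 0 := sub_ne_zero.2 (Ne.symm hbc)
      have := ne hb
      have := ne hc
      have := ne hd
      field_simp
      ring
  have h2 : crossRatio (1 : Circle) b c d =
      (((lineCoord d - lineCoord c) / (lineCoord c - lineCoord b) : ℝ) : ℂ) := by
    rw [h1, inv_sub_one_eq hb, inv_sub_one_eq hc, inv_sub_one_eq hd]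
    have e (x y : ℝ) : ((x * Complex.I - 1) / 2 - (y * Complex.I - 1) / 2 : ℂ) =
        (x - y) * (Complex.I / 2) := by ring
    rw [e, e, mul_div_mul_right _ _ (div_ne_zero Complex.I_ne_zero two_ne_zero)]
    push_cast
    ring
  rw [quadShear, h2, Complex.ofReal_re]

theorem lineCoord_exp (x : ℝ) : lineCoord (Circle.exp (Real.pi + 2 * x)) = Real.tan x := by
  have hz : (Circle.exp (Real.pi + 2 * x) : ℂ) - 1 =
      ⟨-2 * Real.cos x ^ 2, -2 * Real.sin x * Real.cos x⟩ := by
    rw [Circle.coe_exp, Complex.exp_mul_I]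
    apply Complex.ext
    · simp only [Complex.sub_re, Complex.add_re, Complex.mul_re, Complex.I_re, Complex.I_im,
        Complex.one_re, Complex.cos_ofReal_re, Complex.sin_ofReal_im]
      rw [add_comm Real.pi, Real.cos_add_pi, Real.cos_two_mul]
      ring
    · simp only [Complex.sub_im, Complex.add_im, Complex.mul_im, Complex.I_re, Complex.I_im,
        Complex.one_im, Complex.cos_ofReal_im, Complex.sin_ofReal_re]
      rw [add_comm Real.pi, Real.sin_add_pi, Real.sin_two_mul]
      ring
  have hs := Real.sin_sq_add_cos_sq x
  have hn : Complex.normSq ⟨-2 * Real.cos x ^ 2, -2 * Real.sin x * Real.cos x⟩ =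
      4 * Real.cos x ^ 2 := by
    rw [Complex.normSq_mk]
    linear_combination 4 * Real.cos x ^ 2 * hs
  rw [lineCoord, hz, Complex.inv_im, hn, Real.tan_eq_sin_div_cos]
  -- Here the point is `1`, and both sides take the default value `0`.
  by_cases hc : Real.cos x = 0
  · simp [hc]
  · field_simp
    ring

/-! The fan of Farey triangles at the vertex `1`. -/

/-- The vertices of the fan at `1`: the point with coordinate `n` in the half-plane model. -/
noncomputable def fanVertex (n : ℕ) : Circle := Circle.exp (Real.pi + 2 * Real.arctan n)

theorem lineCoord_fanVertex (n : ℕ) : lineCoord (fanVertex n) = n := by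
  rw [fanVertex, lineCoord_exp, Real.tan_arctan]

theorem fanVertex_ne_one (n : ℕ) : fanVertex n ≠ 1 := by
  intro h
  obtain ⟨m, hm⟩ := Circle.exp_eq_one.1 h
  have h1 := Real.arctan_lt_pi_div_two n
  have h2 := Real.neg_pi_div_two_lt_arctan n
  have hpi := Real.pi_pos
  have h3 : (0 : ℝ) < m := by by_contra! h; nlinarith
  have h4 : (m : ℝ) < 1 := by by_contra! h; nlinarith
  have h3' : 0 < m := by exact_mod_cast h3
  have h4' : m < 1 := by exact_mod_cast h4
  omega

theorem coe_fanVertex (n : ℕ) : (fanVertex n : ℂ) = rationalVertex n 1 := by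
  have h := inv_sub_one_eq (fanVertex_ne_one n)
  rw [lineCoord_fanVertex] at h
  have h0 : (n : ℂ) + Complex.I ≠ 0 := fun h => by simpa using congrArg Complex.im h
  have h1 : ((n : ℂ) * Complex.I - 1) = Complex.I * (n + Complex.I) := by
    linear_combination -Complex.I_sq
  have h2 : (fanVertex n : ℂ) = 1 + (((fanVertex n : ℂ) - 1)⁻¹)⁻¹ := by rw [inv_inv]; ring
  have hI := Complex.I_ne_zero
  rw [h2, h, rationalVertex]
  push_cast
  rw [h1, one_mul]
  field_simp
  linear_combination (2 : ℂ) * Complex.I_sq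

theorem fanVertex_injective : Function.Injective fanVertex := by
  intro m n h
  have := congrArg lineCoord h
  rw [lineCoord_fanVertex, lineCoord_fanVertex] at this
  exact_mod_cast this

theorem tendsto_fanVertex : Tendsto fanVertex atTop (𝓝 1) := by
  have h1 : Tendsto (fun n : ℕ => Real.arctan n) atTop (𝓝 (Real.pi / 2)) :=
    (Real.tendsto_arctan_atTop.mono_right nhdsWithin_le_nhds).comp tendsto_natCast_atTop_atTop
  have h2 : Tendsto (fun n : ℕ => Real.pi + 2 * Real.arctan n) atTop (𝓝 (2 * Real.pi)) := by
    convert (h1.const_mul 2).const_add Real.pi using 2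
    ring
  rw [← Circle.exp_two_pi]
  exact (Circle.exp.continuous.tendsto _).comp h2

/-- The base triangle has coordinates infinity, `-1`, `0`; reflecting in the vertical line over `n +
1` exchanges `n` and `n + 2`. -/
theorem fareyTriangle_fan (n : ℕ) : FareyTriangle 1 (fanVertex n) (fanVertex (n + 1)) := by
  -- Infinity is written `-1 / 0` so that the determinant is `-1` and the middle vertex is the
  -- mediant `(-1 + (n + 1)) / (0 + 1) = n`.
  have h1 : ((1 : Circle) : ℂ) = rationalVertex (-1) 0 := by simp [rationalVertex]
  induction n with
  | zero =>
    have hI : (circleI : ℂ) = rationalVertex (-1 + 0) (0 + 1) := by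
      simp only [rationalVertex, circleI]
      push_cast
      rw [eq_div_iff (fun h => by simpa using congrArg Complex.im h)]
      linear_combination Complex.I_sq
    have h0 : (-1 : Circle) = fanVertex 0 := by
      apply Circle.ext
      rw [coe_fanVertex]
      simp [rationalVertex]
    have hb := FareyTriangle.base
    rw [h0] at hb
    refine hb.reflect ?_
    rw [geodesicReflection_rational (p := -1) (q := 0) (r := 0) (s := 1) (by norm_num) h1 hI
      (by simp [coe_fanVertex]), coe_fanVertex]
    simp
  | succ n ih =>
    refine ih.reflect ?_
    rw [geodesicReflection_rational (p := -1) (q := 0) (r := n + 1) (s := 1) (by norm_num) h1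
      (by simp [coe_fanVertex]) (by simp [coe_fanVertex]), coe_fanVertex]
    congr 1

/-- The edges of the fan at `1`. -/
noncomputable def fanEdge (n : ℕ) : FareyEdge :=
  ⟨s(1, fanVertex (n + 1)), 1, fanVertex n, fanVertex (n + 1), fareyTriangle_fan n, rfl⟩

theorem fanEdge_injective : Function.Injective fanEdge := by
  intro m n h
  have h1 : s((1 : Circle), fanVertex (m + 1)) = s(1, fanVertex (n + 1)) :=
    congrArg Subtype.val h
  have := fanVertex_injective (Sym2.congr_right.1 h1)
  omega

theorem shearCoordinate_fanEdge (h : Circle ≃ₜ Circle) (h1 : h 1 = 1) (n : ℕ) :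
    shearCoordinate h (fanEdge n) =
      Real.log ((lineCoord (h (fanVertex (n + 2))) - lineCoord (h (fanVertex (n + 1)))) /
        (lineCoord (h (fanVertex (n + 1))) - lineCoord (h (fanVertex n)))) := by
  have ne (k : ℕ) : h (fanVertex k) ≠ 1 := fun hk =>
    fanVertex_ne_one k (h.injective (hk.trans h1.symm))
  rw [shearCoordinate_eq h (fanEdge n) rfl
    ⟨fareyTriangle_fan n, (fareyTriangle_fan (n + 1)).rotate⟩, h1,
    quadShear_one (ne _) (ne _) (ne _)]

/-! A square-summable shear function that induces no circle homeomorphism. -/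

/-- Shears along the fan at `1` for which the gaps between the images of the vertices are
proportional to `1 / ((n + 1) * (n + 2))`. -/
noncomputable def collapsingShear : FareyEdge → ℝ :=
  Function.extend fanEdge (fun n : ℕ => Real.log ((n + 1) / (n + 3))) 0

theorem collapsingShear_fanEdge (n : ℕ) :
    collapsingShear (fanEdge n) = Real.log ((n + 1) / (n + 3)) :=
  fanEdge_injective.extend_apply _ _ n

theorem collapsingShear_mem : collapsingShear ∈ SquareSummable := by
  have h0 : ∀ e ∉ Set.range fanEdge, collapsingShear e ^ 2 = 0 := by
    intro e he
    rw [collapsingShear, Function.extend_apply' _ _ _ (by simpa using he)]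
    simp
  refine (fanEdge_injective.summable_iff h0).1 ?_
  have hs : Summable fun n : ℕ => 4 * (1 / ((n + 1 : ℕ) : ℝ) ^ 2) :=
    ((summable_nat_add_iff 1).2 (Real.summable_one_div_nat_pow.2 one_lt_two)).mul_left 4
  refine Summable.of_nonneg_of_le (fun n => sq_nonneg _) (fun n => ?_) hs
  simp only [Function.comp_apply, collapsingShear_fanEdge]
  have hn : (0 : ℝ) ≤ n := n.cast_nonneg
  have h1 : Real.log ((n + 1) / (n + 3) : ℝ) ≤ 0 :=
    Real.log_nonpos (by positivity) (by rw [div_le_one (by positivity)]; linarith)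
  -- The bound `1 - 1 / x ≤ log x` gives `-2 / (n + 1)`, so the squares are dominated by `4 / (n +
  -- 1) ^ 2`.
  have h2 := Real.one_sub_inv_le_log_of_pos (x := (n + 1) / (n + 3)) (by positivity)
  have h3 : 1 - ((n + 1) / (n + 3) : ℝ)⁻¹ = -(2 / (n + 1)) := by
    field_simp
    ring
  rw [h3] at h2
  have h4 : (4 * (1 / ((n + 1 : ℕ) : ℝ) ^ 2) : ℝ) = (2 / (n + 1)) ^ 2 := by
    push_cast
    field_simp
    norm_num
  rw [h4]
  exact sq_le_sq' h2 (h1.trans (by positivity))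

/-- A circle homeomorphism fixing `1` moves the fan vertices off to infinity, so the gaps between
their images cannot shrink quadratically. -/
theorem shearCoordinate_ne_collapsingShear {h : Circle ≃ₜ Circle} (h1 : h 1 = 1) :
    shearCoordinate h ≠ collapsingShear := by
  intro hs
  set T : ℕ → ℝ := fun n => lineCoord (h (fanVertex n)) with hT
  have ne (k : ℕ) : h (fanVertex k) ≠ 1 := fun hk =>
    fanVertex_ne_one k (h.injective (hk.trans h1.symm))
  have hgap (n : ℕ) : T (n + 1) - T n ≠ 0 := by
    rw [sub_ne_zero]
    intro hn
    have := fanVertex_injective (h.injective (lineCoord_injOn (ne _) (ne _) hn))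
    omega
  -- Absolute values suffice, since `Real.log` ignores signs; orientation is never needed.
  have hstep (n : ℕ) : |T (n + 2) - T (n + 1)| = (n + 1) / (n + 3) * |T (n + 1) - T n| := by
    have h2 := congrFun hs (fanEdge n)
    rw [shearCoordinate_fanEdge h h1, collapsingShear_fanEdge] at h2
    have h3 := congrArg Real.exp h2
    rw [Real.exp_log_eq_abs (div_ne_zero (hgap (n + 1)) (hgap n)),
      Real.exp_log (by positivity), abs_div,
      div_eq_iff (abs_ne_zero.2 (hgap n))] at h3
    exact h3
  -- The product of `(k + 1) / (k + 3)` over `k < n` telescopes to `2 / ((n + 1) * (n + 2))`.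
  have hgaps (n : ℕ) : |T (n + 1) - T n| = 2 * |T 1 - T 0| / ((n + 1) * (n + 2)) := by
    induction n with
    | zero => norm_num
    | succ n ih =>
      rw [hstep, ih]
      push_cast
      field_simp
      ring
  -- The gaps sum by partial fractions.
  have hbound (n : ℕ) : |T n| ≤ |T 0| + 2 * |T 1 - T 0| * (1 - 1 / (n + 1)) := by
    induction n with
    | zero => norm_num
    | succ n ih =>
      have h2 : |T (n + 1)| ≤ |T n| + |T (n + 1) - T n| := by
        have := abs_add_le (T n) (T (n + 1) - T n)
        rwa [add_sub_cancel] at this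
      have h3 : 2 * |T 1 - T 0| / ((n + 1) * (n + 2) : ℝ) =
          2 * |T 1 - T 0| * (1 - 1 / ((n + 1 : ℕ) + 1)) -
            2 * |T 1 - T 0| * (1 - 1 / (n + 1)) := by
        push_cast
        field_simp
        ring
      rw [hgaps, h3] at h2
      linarith
  set B : ℝ := |T 0| + 2 * |T 1 - T 0| + 1 with hB
  have hBn (n : ℕ) : |T n| + 1 ≤ B := by
    have h2 := hbound n
    have h3 : 2 * |T 1 - T 0| * (1 - 1 / (n + 1)) ≤ 2 * |T 1 - T 0| * 1 := by
      apply mul_le_mul_of_nonneg_left _ (by positivity)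
      have : (0 : ℝ) ≤ 1 / (n + 1) := by positivity
      linarith
    linarith
  have hlim : Tendsto (fun n => ‖(h (fanVertex n) : ℂ) - 1‖ * B) atTop (𝓝 0) := by
    have hc : Continuous fun z : Circle => ‖(h z : ℂ) - 1‖ * B := by fun_prop
    have := (hc.tendsto 1).comp tendsto_fanVertex
    simpa [h1, Function.comp_def] using this
  have hone (n : ℕ) : 1 ≤ ‖(h (fanVertex n) : ℂ) - 1‖ * B :=
    (one_le_norm_sub_one_mul (ne n)).trans (mul_le_mul_of_nonneg_left (hBn n) (norm_nonneg _))
  have := ge_of_tendsto' hlim hone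
  norm_num at this

/-! Circle homeomorphisms with a displacement of small Lipschitz constant. -/

/-- Twice the signed area of the inscribed triangle; the product of sines makes its sign readable
from the angles. -/
theorem im_conj_mul_exp (a b c : ℝ) :
    (conj ((Circle.exp b : ℂ) - Circle.exp a) * ((Circle.exp c : ℂ) - Circle.exp a)).im =
      4 * (Real.sin ((b - a) / 2) * Real.sin ((c - b) / 2) * Real.sin ((c - a) / 2)) := by
  have h1 : (conj ((Circle.exp b : ℂ) - Circle.exp a) *
      ((Circle.exp c : ℂ) - Circle.exp a)).im =
      Real.sin (c - b) + Real.sin (b - a) - Real.sin (c - a) := by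
    simp only [Circle.coe_exp, Complex.exp_mul_I, Complex.mul_im, Complex.conj_re,
      Complex.conj_im, Complex.sub_re, Complex.sub_im, Complex.add_re, Complex.add_im,
      Complex.mul_re, Complex.I_re, Complex.I_im, Complex.cos_ofReal_re, Complex.cos_ofReal_im,
      Complex.sin_ofReal_re, Complex.sin_ofReal_im, Real.sin_sub]
    ring
  rw [h1]
  obtain ⟨p, hp⟩ : ∃ p, p = (b - a) / 2 := ⟨_, rfl⟩
  obtain ⟨q, hq⟩ : ∃ q, q = (c - b) / 2 := ⟨_, rfl⟩
  have e1 : b - a = 2 * p := by rw [hp]; ring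
  have e2 : c - b = 2 * q := by rw [hq]; ring
  have e3 : c - a = 2 * (p + q) := by rw [hp, hq]; ring
  have e4 : (c - a) / 2 = p + q := by rw [hp, hq]; ring
  rw [e4, ← hp, ← hq, e1, e2, e3, Real.sin_two_mul, Real.sin_two_mul, Real.sin_two_mul,
    Real.sin_add, Real.cos_add]
  have hp1 := Real.sin_sq_add_cos_sq p
  have hq1 := Real.sin_sq_add_cos_sq q
  linear_combination (-2 * Real.sin p * Real.cos p) * hq1 + (-2 * Real.sin q * Real.cos q) * hp1

theorem counterclockwise_exp_of_lt {a b c : ℝ} (hab : a < b) (hbc : b < c)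
    (hca : c < a + 2 * Real.pi) :
    Counterclockwise (Circle.exp a) (Circle.exp b) (Circle.exp c) := by
  rw [Counterclockwise, im_conj_mul_exp]
  have h1 := Real.sin_pos_of_pos_of_lt_pi (x := (b - a) / 2) (by linarith) (by linarith)
  have h2 := Real.sin_pos_of_pos_of_lt_pi (x := (c - b) / 2) (by linarith) (by linarith)
  have h3 := Real.sin_pos_of_pos_of_lt_pi (x := (c - a) / 2) (by linarith) (by linarith)
  positivity

theorem exists_exp_eq_mem_Ico (a : ℝ) (z : Circle) :
    ∃ b, a ≤ b ∧ b < a + 2 * Real.pi ∧ Circle.exp b = z := by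
  obtain ⟨x, rfl⟩ := Circle.exp_surjective z
  have h := toIcoMod_mem_Ico Real.two_pi_pos a x
  refine ⟨toIcoMod Real.two_pi_pos a x, h.1, h.2, ?_⟩
  rw [Circle.exp_eq_exp]
  exact ⟨-toIcoDiv Real.two_pi_pos a x, by
    have := self_sub_toIcoDiv_zsmul Real.two_pi_pos a x
    rw [zsmul_eq_mul] at this
    push_cast
    linarith⟩

/-- With `b` and `c` lifted to `[a, a + 2π)`, only the sine of `(c - b) / 2` can be negative, so
positivity forces `a < b < c`. -/
theorem Counterclockwise.exists_lift {z w v : Circle} (h : Counterclockwise z w v) :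
    ∃ a b c : ℝ, a < b ∧ b < c ∧ c < a + 2 * Real.pi ∧
      Circle.exp a = z ∧ Circle.exp b = w ∧ Circle.exp c = v := by
  obtain ⟨a, rfl⟩ := Circle.exp_surjective z
  obtain ⟨b, hb1, hb2, rfl⟩ := exists_exp_eq_mem_Ico a w
  obtain ⟨c, hc1, hc2, rfl⟩ := exists_exp_eq_mem_Ico a v
  rw [Counterclockwise, im_conj_mul_exp] at h
  have h1 := Real.sin_nonneg_of_nonneg_of_le_pi (x := (b - a) / 2) (by linarith) (by linarith)
  have h3 := Real.sin_nonneg_of_nonneg_of_le_pi (x := (c - a) / 2) (by linarith) (by linarith)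
  refine ⟨a, b, c, ?_, ?_, hc2, rfl, rfl, rfl⟩
  · rcases hb1.lt_or_eq with h4 | rfl
    · exact h4
    · simp at h
  · by_contra! h4
    have h2 := Real.sin_nonpos_of_nonpos_of_neg_pi_le (x := (c - b) / 2) (by linarith)
      (by linarith)
    have := mul_nonpos_of_nonpos_of_nonneg (mul_nonpos_of_nonneg_of_nonpos h1 h2) h3
    linarith

theorem exists_homeo_of_displacement {δ : ℝ → ℝ} (hper : Function.Periodic δ (2 * Real.pi))
    (hlip : ∀ x y, |δ y - δ x| ≤ 1 / 2 * |y - x|) :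
    ∃ h : Circle ≃ₜ Circle, (∀ x, h (Circle.exp x) = Circle.exp (x + δ x)) ∧
      OrientationPreserving h ∧ Quasisymmetric h := by
  set φ : ℝ → ℝ := fun x => x + δ x with hφ
  have hlow {x y : ℝ} (hxy : x ≤ y) : 1 / 2 * (y - x) ≤ φ y - φ x := by
    have h1 := hlip x y
    rw [abs_of_nonneg (sub_nonneg.2 hxy)] at h1
    have := (abs_le.1 h1).1
    simp only [hφ]
    linarith
  have hupp {x y : ℝ} (hxy : x ≤ y) : φ y - φ x ≤ 3 / 2 * (y - x) := by
    have h1 := hlip x y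
    rw [abs_of_nonneg (sub_nonneg.2 hxy)] at h1
    have := (abs_le.1 h1).2
    simp only [hφ]
    linarith
  have hmono : StrictMono φ := fun x y hxy => by
    have := hlow hxy.le
    linarith
  have hδc : Continuous δ := by
    refine (LipschitzWith.of_dist_le_mul (K := 1 / 2) fun x y => ?_).continuous
    simpa [Real.dist_eq] using hlip y x
  have hcont : Continuous φ := continuous_id.add hδc
  have htop : Tendsto φ atTop atTop := by
    refine tendsto_atTop_mono' atTop (f₁ := fun x => φ 0 + 1 / 2 * x) ?_
      (tendsto_atTop_add_const_left _ _ (tendsto_id.const_mul_atTop (by norm_num)))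
    filter_upwards [eventually_ge_atTop 0] with x hx
    have := hlow hx
    linarith
  have hbot : Tendsto φ atBot atBot := by
    refine tendsto_atBot_mono' atBot ?_ (tendsto_atBot_add_const_left _ (φ 0)
      (tendsto_id.const_mul_atBot (one_half_pos (α := ℝ))))
    filter_upwards [eventually_le_atBot 0] with x hx
    have := hlow hx
    simp only [id]
    linarith
  have hsurj : Function.Surjective φ := hcont.surjective htop hbot
  have hshift (x : ℝ) (m : ℤ) : φ (x + m * (2 * Real.pi)) = φ x + m * (2 * Real.pi) := by
    simp only [hφ]
    rw [hper.int_mul m x]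
    ring
  -- The branch of `arg` is irrelevant because `φ` commutes with translation by `2π`; continuity
  -- descends through the covering `Circle.exp`.
  let f : Circle → Circle := fun z => Circle.exp (φ (Complex.arg z))
  have hf (x : ℝ) : f (Circle.exp x) = Circle.exp (φ x) := by
    obtain ⟨m, hm⟩ := Circle.exp_eq_exp.1 (Circle.exp_arg (Circle.exp x))
    change Circle.exp (φ (Complex.arg (Circle.exp x))) = _
    rw [hm, hshift]
    exact Circle.exp_eq_exp.2 ⟨m, rfl⟩
  have hfc : Continuous f := by
    rw [(Circle.isCoveringMap_exp.isQuotientMap Circle.exp_surjective).continuous_iff]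
    have : f ∘ Circle.exp = fun x => Circle.exp (φ x) := funext hf
    rw [this]
    exact Circle.exp.continuous.comp hcont
  have hfb : Function.Bijective f := by
    constructor
    · intro z w hzw
      obtain ⟨x, rfl⟩ := Circle.exp_surjective z
      obtain ⟨y, rfl⟩ := Circle.exp_surjective w
      rw [hf, hf] at hzw
      obtain ⟨m, hm⟩ := Circle.exp_eq_exp.1 hzw
      rw [← hshift] at hm
      exact Circle.exp_eq_exp.2 ⟨m, hmono.injective hm⟩
    · intro z
      obtain ⟨x, rfl⟩ := Circle.exp_surjective z
      obtain ⟨y, rfl⟩ := hsurj x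
      exact ⟨Circle.exp y, hf y⟩
  let h : Circle ≃ₜ Circle :=
    Continuous.homeoOfEquivCompactToT2 (f := Equiv.ofBijective f hfb) hfc
  have hh (x : ℝ) : h (Circle.exp x) = Circle.exp (φ x) := hf x
  -- The difference quotients of `φ` lie in `[1/2, 3/2]`, so `M = 3` works.
  refine ⟨h, hh, ?_, φ, hcont, hmono, hh, 3, by norm_num, ?_⟩
  · intro z w v hzwv
    obtain ⟨a, b, c, hab, hbc, hca, rfl, rfl, rfl⟩ := hzwv.exists_lift
    rw [hh, hh, hh]
    refine counterclockwise_exp_of_lt (hmono hab) (hmono hbc) ?_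
    have h1 := hmono hca
    have h2 := hshift a 1
    simp only [Int.cast_one, one_mul] at h2
    rwa [h2] at h1
  · intro x t ht _
    have h1 := hlow (x := x) (y := x + t) (by linarith)
    have h2 := hupp (x := x) (y := x + t) (by linarith)
    have h3 := hlow (x := x - t) (y := x) (by linarith)
    have h4 := hupp (x := x - t) (y := x) (by linarith)
    have hpos : 0 < φ x - φ (x - t) := by linarith
    rw [le_div_iff₀ hpos, div_le_iff₀ hpos]
    constructor <;> linarith

/-! A displacement that moves every third vertex of the fan at `1` and fixes the others. -/

/-- A function of period `3` that vanishes at `0` and `2` but not at `1`. -/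
noncomputable def threeWave (t : ℝ) : ℝ := 1 / 2 - Real.cos (Real.pi * (2 * t + 1) / 3)

theorem cos_five_pi_div_three : Real.cos (5 * Real.pi / 3) = 1 / 2 := by
  rw [show 5 * Real.pi / 3 = 2 * Real.pi - Real.pi / 3 by ring, Real.cos_two_pi_sub,
    Real.cos_pi_div_three]

theorem threeWave_three_mul (j : ℕ) : threeWave (3 * j) = 0 := by
  rw [threeWave, show Real.pi * (2 * (3 * j) + 1) / 3 = Real.pi / 3 + j * (2 * Real.pi) by ring,
    Real.cos_add_nat_mul_two_pi, Real.cos_pi_div_three, sub_self]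

theorem threeWave_three_mul_add_one (j : ℕ) : threeWave (3 * j + 1) = 3 / 2 := by
  rw [threeWave, show Real.pi * (2 * (3 * j + 1) + 1) / 3 = Real.pi + j * (2 * Real.pi) by ring,
    Real.cos_add_nat_mul_two_pi, Real.cos_pi]
  norm_num

theorem threeWave_three_mul_add_two (j : ℕ) : threeWave (3 * j + 2) = 0 := by
  rw [threeWave,
    show Real.pi * (2 * (3 * j + 2) + 1) / 3 = 5 * Real.pi / 3 + j * (2 * Real.pi) by ring,
    Real.cos_add_nat_mul_two_pi, cos_five_pi_div_three, sub_self]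

/-- Coordinate `-1` is the point `i`, which must stay fixed. -/
theorem threeWave_neg_one : threeWave (-1) = 0 := by
  rw [threeWave, show Real.pi * (2 * (-1) + 1) / 3 = -(Real.pi / 3) by ring, Real.cos_neg,
    Real.cos_pi_div_three, sub_self]

theorem abs_threeWave_le (t : ℝ) : |threeWave t| ≤ 3 / 2 := by
  have h1 := Real.neg_one_le_cos (Real.pi * (2 * t + 1) / 3)
  have h2 := Real.cos_le_one (Real.pi * (2 * t + 1) / 3)
  rw [threeWave, abs_le]
  constructor <;> linarith

theorem hasDerivAt_threeWave (t : ℝ) :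
    HasDerivAt threeWave (Real.sin (Real.pi * (2 * t + 1) / 3) * (2 * Real.pi / 3)) t := by
  have h1 : HasDerivAt (fun t : ℝ => Real.pi * (2 * t + 1) / 3) (2 * Real.pi / 3) t := by
    refine (((((hasDerivAt_id t).const_mul 2).add_const 1).const_mul Real.pi).div_const 3
      ).congr_deriv ?_
    ring
  refine (h1.cos.const_sub (1 / 2)).congr_deriv ?_
  ring

/-- The displacement, in the angular coordinate; `-cos (θ / 2) / sin (θ / 2)` is the coordinate of
`exp (i θ)` in the half-plane model. -/
noncomputable def waveDisplacement (θ : ℝ) : ℝ :=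
  1 / 8 * (Real.sin (θ / 2) ^ 2 * threeWave (-(Real.cos (θ / 2) / Real.sin (θ / 2))))

theorem waveDisplacement_periodic : Function.Periodic waveDisplacement (2 * Real.pi) := by
  intro θ
  simp only [waveDisplacement]
  rw [show (θ + 2 * Real.pi) / 2 = θ / 2 + Real.pi by ring, Real.sin_add_pi, Real.cos_add_pi,
    neg_sq, neg_div_neg_eq]

theorem waveDisplacement_zero : waveDisplacement 0 = 0 := by simp [waveDisplacement]

theorem waveDisplacement_arctan (t : ℝ) :
    waveDisplacement (Real.pi + 2 * Real.arctan t) = 1 / 8 * (threeWave t / (1 + t ^ 2)) := by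
  rw [waveDisplacement, show (Real.pi + 2 * Real.arctan t) / 2 = Real.arctan t + Real.pi / 2 by
    ring, Real.sin_add_pi_div_two, Real.cos_add_pi_div_two, neg_div, neg_neg,
    ← Real.tan_eq_sin_div_cos, Real.tan_arctan, Real.cos_sq_arctan]
  ring

/-- The line coordinate has derivative `1 / (2 * sin (θ / 2) ^ 2)`, which the factor `sin (θ / 2) ^
2` cancels. At the point `1` the wave oscillates infinitely often, but the same factor makes the
displacement vanish to second order. -/
theorem exists_hasDerivAt_waveDisplacement (θ : ℝ) :
    ∃ d, HasDerivAt waveDisplacement d θ ∧ |d| ≤ 1 / 2 := by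
  have hhalf : HasDerivAt (fun θ : ℝ => θ / 2) (1 / 2) θ := (hasDerivAt_id θ).div_const 2
  have hs := hhalf.sin
  have hc := hhalf.cos
  by_cases h0 : Real.sin (θ / 2) = 0
  · refine ⟨0, ?_, by norm_num⟩
    have hsq : HasDerivAt (fun θ : ℝ => Real.sin (θ / 2) ^ 2) 0 θ := by
      refine (hs.pow 2).congr_deriv ?_
      simp [h0]
    rw [hasDerivAt_iff_isLittleO] at hsq ⊢
    refine Asymptotics.IsBigO.trans_isLittleO ?_ hsq
    refine Asymptotics.IsBigO.of_bound 1 (Eventually.of_forall fun y => ?_)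
    have h1 : waveDisplacement θ = 0 := by simp [waveDisplacement, h0]
    have h2 := abs_threeWave_le (-(Real.cos (y / 2) / Real.sin (y / 2)))
    have h3 : 0 ≤ Real.sin (y / 2) ^ 2 := sq_nonneg _
    have h4 := mul_le_mul_of_nonneg_left h2 h3
    simp only [h1, h0, smul_zero, sub_zero, Real.norm_eq_abs, one_mul]
    rw [waveDisplacement, abs_mul, abs_mul, abs_of_nonneg h3, abs_of_pos (by norm_num)]
    norm_num
    linarith
  · set t := -(Real.cos (θ / 2) / Real.sin (θ / 2)) with ht
    have hr : HasDerivAt (fun θ : ℝ => -(Real.cos (θ / 2) / Real.sin (θ / 2)))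
        (1 / 2 / Real.sin (θ / 2) ^ 2) θ := by
      refine (hc.div hs h0).neg.congr_deriv ?_
      rw [← neg_div]
      congr 1
      linear_combination (1 / 2 : ℝ) * Real.sin_sq_add_cos_sq (θ / 2)
    have hF := (hasDerivAt_threeWave t).comp θ hr
    have hd := ((hs.pow 2).mul hF).const_mul (1 / 8)
    -- The bracket is at most `3/2 + 4/3 < 4`; the factor `1 / 8` brings it below `1 / 2`.
    refine ⟨1 / 8 * (Real.sin (θ / 2) * Real.cos (θ / 2) * threeWave t +
      Real.sin (Real.pi * (2 * t + 1) / 3) * (Real.pi / 3)), ?_, ?_⟩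
    · refine hd.congr_deriv ?_
      simp only [Function.comp_apply, ← ht]
      field_simp
      simp
      ring
    · have h1 : |Real.sin (θ / 2) * Real.cos (θ / 2) * threeWave t| ≤ 1 * 1 * (3 / 2) := by
        rw [abs_mul, abs_mul]
        gcongr
        · exact Real.abs_sin_le_one _
        · exact Real.abs_cos_le_one _
        · exact abs_threeWave_le t
      have h2 : |Real.sin (Real.pi * (2 * t + 1) / 3) * (Real.pi / 3)| ≤ 1 * (4 / 3) := by
        rw [abs_mul, abs_of_pos (by positivity : 0 < Real.pi / 3)]
        have := Real.pi_lt_four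
        gcongr
        exact Real.abs_sin_le_one _
      have h3 := abs_add_le (Real.sin (θ / 2) * Real.cos (θ / 2) * threeWave t)
        (Real.sin (Real.pi * (2 * t + 1) / 3) * (Real.pi / 3))
      rw [abs_mul, abs_of_pos (by norm_num : (0 : ℝ) < 1 / 8)]
      linarith

theorem abs_waveDisplacement_sub_le (x y : ℝ) :
    |waveDisplacement y - waveDisplacement x| ≤ 1 / 2 * |y - x| := by
  choose d hd hb using exists_hasDerivAt_waveDisplacement
  exact convex_univ.norm_image_sub_le_of_norm_hasDerivWithin_le
    (fun x _ => (hd x).hasDerivWithinAt) (fun x _ => hb x) (Set.mem_univ x) (Set.mem_univ y)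

/-- The displaced vertices move by a definite amount in the half-plane coordinate. -/
theorem tan_arctan_add_sub_mem {t : ℝ} (ht : 0 ≤ t) :
    Real.tan (Real.arctan t + 3 / 32 / (1 + t ^ 2)) - t ∈ Set.Icc (3 / 64 : ℝ) (3 / 16) := by
  -- The angular displacement where the wave equals `3 / 2` is `3 / 16 / (1 + t ^ 2)`; it is halved
  -- because the angle is `π + 2 * arctan t`. As `tan` has slope `1 + t ^ 2` there, the shift is
  -- about `3 / 32`, and the stated bounds are half and twice that.
  set η : ℝ := 3 / 32 / (1 + t ^ 2) with hη
  have hη0 : 0 < η := by positivity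
  have hmul : (1 + t ^ 2) * η = 3 / 32 := by rw [hη]; field_simp
  have hη1 : η ≤ 3 / 32 := by nlinarith [sq_nonneg t]
  have htη : t * η ≤ 3 / 32 := by nlinarith [sq_nonneg (t - 1)]
  have hs1 : Real.sin η ≤ η := Real.sin_le hη0.le
  have hs2 : η / 2 ≤ Real.sin η := by
    have := Real.sin_gt_sub_cube hη0
    nlinarith [mul_pos hη0 hη0]
  have hc1 : Real.cos η ≤ 1 := Real.cos_le_one _
  have hc2 : 1 - η ^ 2 / 2 ≤ Real.cos η := Real.one_sub_sq_div_two_le_cos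
  have hD1 : 1 / 2 ≤ Real.cos η - t * Real.sin η := by
    have := mul_le_mul_of_nonneg_left hs1 ht
    nlinarith
  have hD2 : Real.cos η - t * Real.sin η ≤ 1 := by
    have := mul_nonneg ht (hs2.trans' (by positivity))
    linarith
  have hc := Real.cos_arctan_pos t
  have hsin : Real.sin (Real.arctan t) = t * Real.cos (Real.arctan t) := by
    have := Real.tan_arctan t
    rw [Real.tan_eq_sin_div_cos, div_eq_iff hc.ne'] at this
    exact this
  have hcs : Real.cos (Real.arctan t) ^ 2 * (1 + t ^ 2) = 1 := by
    rw [Real.cos_sq_arctan]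
    field_simp
  have hx : Real.tan (Real.arctan t + η) - t =
      (1 + t ^ 2) * Real.sin η / (Real.cos η - t * Real.sin η) := by
    have hD0 : Real.cos η - t * Real.sin η ≠ 0 := by linarith
    have e : Real.cos (Real.arctan t + η) =
        Real.cos (Real.arctan t) * (Real.cos η - t * Real.sin η) := by
      rw [Real.cos_add, hsin]
      ring
    have e' : Real.sin (Real.arctan t + η) =
        Real.cos (Real.arctan t) * (t * Real.cos η + Real.sin η) := by
      rw [Real.sin_add, hsin]
      ring
    rw [Real.tan_eq_sin_div_cos, e, e', mul_div_mul_left _ _ hc.ne']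
    field_simp
    ring
  have hpos : 0 < Real.cos η - t * Real.sin η := by linarith
  have ht2 : 0 ≤ 1 + t ^ 2 := by positivity
  have m1 := mul_le_mul_of_nonneg_left hs1 ht2
  have m2 := mul_le_mul_of_nonneg_left hs2 ht2
  rw [hx, Set.mem_Icc, le_div_iff₀ hpos, div_le_iff₀ hpos]
  constructor <;> linarith

/-! ### Normalization and the quasisymmetric example. -/

theorem exp_pi_div_two : Circle.exp (Real.pi / 2) = circleI := by
  apply Circle.ext
  rw [Circle.coe_exp, circleI]
  push_cast
  exact Complex.exp_pi_div_two_mul_I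

theorem exp_pi : Circle.exp Real.pi = -1 := by
  apply Circle.ext
  rw [Circle.coe_exp, Complex.exp_pi_mul_I]
  rfl

theorem exp_waveDisplacement_of_threeWave_eq_zero {t : ℝ} (ht : threeWave t = 0) :
    Circle.exp (Real.pi + 2 * Real.arctan t +
      waveDisplacement (Real.pi + 2 * Real.arctan t)) =
    Circle.exp (Real.pi + 2 * Real.arctan t) := by
  rw [waveDisplacement_arctan, ht]
  simp

theorem exists_quasisymmetric_not_squareSummable :
    ∃ h : Circle ≃ₜ Circle, h ∈ NormalizedHomeo ∧ Quasisymmetric h ∧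
      shearCoordinate h ∉ SquareSummable := by
  obtain ⟨h, hh, ho, hq⟩ :=
    exists_homeo_of_displacement waveDisplacement_periodic abs_waveDisplacement_sub_le
  have hfix {t : ℝ} (ht : threeWave t = 0) : h (Circle.exp (Real.pi + 2 * Real.arctan t)) =
      Circle.exp (Real.pi + 2 * Real.arctan t) :=
    (hh _).trans (exp_waveDisplacement_of_threeWave_eq_zero ht)
  have h1 : h 1 = 1 := by
    have := hh 0
    rwa [waveDisplacement_zero, add_zero, Circle.exp_zero] at this
  have hI : h circleI = circleI := by
    have := hfix threeWave_neg_one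
    rwa [Real.arctan_neg, Real.arctan_one,
      show Real.pi + 2 * -(Real.pi / 4) = Real.pi / 2 by ring, exp_pi_div_two] at this
  have hneg : h (-1) = -1 := by
    have := hfix (by simpa using threeWave_three_mul 0)
    rwa [Real.arctan_zero, mul_zero, add_zero, exp_pi] at this
  refine ⟨h, ⟨ho, h1, hI, hneg⟩, hq, fun hsum => ?_⟩
  -- If the middle vertex moves by `x`, the gap ratio is `(1 - x) / (1 + x) ≤ 1 - x`, and `x ≥ 3 /
  -- 64`.
  have hshear (j : ℕ) : Real.exp (shearCoordinate h (fanEdge (3 * j))) ≤ 61 / 64 := by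
    have f0 : lineCoord (h (fanVertex (3 * j))) = (3 * j : ℕ) := by
      rw [fanVertex, hfix (by push_cast; exact threeWave_three_mul j), lineCoord_exp,
        Real.tan_arctan]
    have f2 : lineCoord (h (fanVertex (3 * j + 2))) = (3 * j + 2 : ℕ) := by
      rw [fanVertex, hfix (by push_cast; exact threeWave_three_mul_add_two j), lineCoord_exp,
        Real.tan_arctan]
    have f1 : lineCoord (h (fanVertex (3 * j + 1))) =
        Real.tan (Real.arctan (3 * j + 1 : ℕ) + 3 / 32 / (1 + ((3 * j + 1 : ℕ) : ℝ) ^ 2)) := by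
      have hw : threeWave ((3 * j + 1 : ℕ) : ℝ) = 3 / 2 := by
        push_cast
        exact threeWave_three_mul_add_one j
      rw [fanVertex, hh, waveDisplacement_arctan, hw, ← lineCoord_exp]
      congr 2
      ring
    have hx := tan_arctan_add_sub_mem (t := (3 * j + 1 : ℕ)) (Nat.cast_nonneg _)
    rw [← f1] at hx
    obtain ⟨hx1, hx2⟩ := hx
    rw [shearCoordinate_fanEdge h h1, f0, f2]
    push_cast at hx1 hx2 ⊢
    have n1 : 0 < 3 * (j : ℝ) + 2 - lineCoord (h (fanVertex (3 * j + 1))) := by linarith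
    have n2 : 0 < lineCoord (h (fanVertex (3 * j + 1))) - 3 * (j : ℝ) := by linarith
    rw [Real.exp_log (div_pos n1 n2), div_le_iff₀ n2]
    linarith
  have hinj : Function.Injective fun j => fanEdge (3 * j) := fun i j hij => by
    have := fanEdge_injective hij
    omega
  -- Summability would force these shears to `0` and their exponentials to `1`, above the bound `61
  -- / 64`.
  have hlim : Tendsto (fun j => |shearCoordinate h (fanEdge (3 * j))|) atTop (𝓝 0) := by
    have := (hsum.comp_injective hinj).tendsto_atTop_zero.sqrt
    simpa [Function.comp_def, Real.sqrt_sq_eq_abs] using this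
  have hexp := (tendsto_zero_iff_abs_tendsto_zero _).2 hlim |>.rexp
  have := le_of_tendsto' hexp hshear
  norm_num at this

end FareyShear

theorem mainTheorem12 :
    (∃ s : FareyShear.FareyEdge → ℝ, s ∈ FareyShear.SquareSummable ∧
      ¬ ∃ h : Circle ≃ₜ Circle, h ∈ FareyShear.NormalizedHomeo ∧
        FareyShear.shearCoordinate h = s) ∧
    (∃ h : Circle ≃ₜ Circle, h ∈ FareyShear.NormalizedHomeo ∧ FareyShear.Quasisymmetric h ∧
      FareyShear.shearCoordinate h ∉ FareyShear.SquareSummable) :=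
  ⟨⟨FareyShear.collapsingShear, FareyShear.collapsingShear_mem, fun ⟨_, hn, hs⟩ =>
    FareyShear.shearCoordinate_ne_collapsingShear hn.2.1 hs⟩,
    FareyShear.exists_quasisymmetric_not_squareSummable⟩
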